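/- **Conventions.** Inner products are linear in the first argument. For $x,\omega\in\mathbb R^d$ and $\varphi\in L^2(\mathbb R^d)$ let $\pi(x,\omega)\varphi(t)=e^{2\pi i\,\omega\cdot t}\varphi(t-x)$. If $(X,\mu)$ is a measure space, $\mathcal H$ a Hilbert space, $m:X\to\mathbb C$ and $F:X\to\mathcal H$, then $\mathbf M_{m,F,F}$ denotes the bounded operator on $\mathcal H$ weakly defined by $$\langle \mathbf M_{m,F,F}f,g\rangle=\int_X m(x)\,\langle f,F(x)\rangle\,\langle F(x),g\rangle\,d\mu(x),\qquad f,g\in\mathcal H,$$ whenever these integrals converge absolutely and define such an operator. A density operator on $\mathcal H$ is a self-adjoint, non-negative trace class operator $\rho$ with $\mathrm{Tr}_{\mathcal H}(\rho)=1$. For a trace class operator $A$ on the Hilbert tensor product $\mathcal H_1\otimes\mathcal H_2$, its partial trace with respect to $\mathcal H_1$ is the operator $T(A)$ on $\mathcal H_1$ with $\langle T(A)x,y\rangle=\sum_i\langle A(x\otimes e_i),y\otimes e_i\rangle$ for all $x,y\in\mathcal H_1$ and every orthonormal basis $(e_i)$ of $\mathcal H_2$ (so that $T(A_1\otimes A_2)=\mathrm{Tr}_{\mathcal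 H_2}(A_2)\,A_1$); the partial trace with respect to $\mathcal H_2$ is defined in the same way with the roles of the factors exchanged. **Theorem 7.4.** Let $\mathcal H=\mathcal H_1\otimes\mathcal H_2$ with $\mathcal H_1=\mathcal H_2=L^2(\mathbb R^d)$, let $\varphi_1,\varphi_2\in L^2(\mathbb R^d)\setminus\{0\}$, and let $m_1,m_2\in L^1(\mathbb R^{2d})\cap L^\infty(\mathbb R^{2d})$ be (almost everywhere) positive functions such that $$\int_{\mathbb R^{2d}}m_j(x_j,\omega_j)\,dx_j\,d\omega_j=\frac1{\|\varphi_j\|^2},\qquad j=1,2.$$ Put $m(x,\omega)=m_1(x_1,\omega_1)\,m_2(x_2,\omega_2)$ and $F(x,\omega)=\pi(x_1,\omega_1)\varphi_1\otimes\pi(x_2,\omega_2)\varphi_2$ for $x=(x_1,x_2)$, $\omega=(\omega_1,\omega_2)\in\mathbb R^{2d}$, and let $\mathbf M_{m_j,\varphi_j,\varphi_j}$ be the operator $\mathbf M_{m_j,F_j,F_j}$ on $L^2(\mathbb R^d)$ with $F_j(x_j,\omega_j)=\pi(x_j,\omega_j)\varphi_j$, where $\mathbb R^{2d}$ and $\mathbb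 R^{4d}$ carry Lebesgue measure. Then the operators $\mathbf M_{m,F,F}$, $\mathbf M_{m_1,\varphi_1,\varphi_1}$ and $\mathbf M_{m_2,\varphi_2,\varphi_2}$ are well defined, $\mathbf M_{m,F,F}$ is a density operator on $\mathcal H$, and for $j=1,2$ its partial trace with respect to $\mathcal H_j$ is $\mathbf M_{m_j,\varphi_j,\varphi_j}$, which is a density operator on $L^2(\mathbb R^d)$. -/

import Mathlib

open MeasureTheory
open scoped InnerProductSpace TensorProduct

universe u v

noncomputable section

namespace QuantumLoc

/-! ### Tensor products of Hilbert spaces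

Mathlib's inner product is conjugate linear in its first argument, so that the inner product
`⟨f, g⟩` which is linear in `f` is written `⟪g, f⟫_ℂ`. -/

/-- The Hilbert tensor product `H₁ ⊗ H₂`: the completion of the algebraic tensor product with
respect to the inner product `⟨x₁ ⊗ y₁, x₂ ⊗ y₂⟩ = ⟨x₁, x₂⟩ ⟨y₁, y₂⟩`. -/
abbrev HTensor (H₁ H₂ : Type*) [NormedAddCommGroup H₁] [InnerProductSpace ℂ H₁]
    [NormedAddCommGroup H₂] [InnerProductSpace ℂ H₂] : Type _ :=
  UniformSpace.Completion (H₁ ⊗[ℂ] H₂)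

/-- The elementary tensor `x ⊗ y` in the Hilbert tensor product. -/
def htmul {H₁ H₂ : Type*} [NormedAddCommGroup H₁] [InnerProductSpace ℂ H₁]
    [NormedAddCommGroup H₂] [InnerProductSpace ℂ H₂] (x : H₁) (y : H₂) : HTensor H₁ H₂ :=
  ((x ⊗ₜ[ℂ] y : H₁ ⊗[ℂ] H₂) : UniformSpace.Completion (H₁ ⊗[ℂ] H₂))

theorem inner_htmul {H₁ H₂ : Type*} [NormedAddCommGroup H₁] [InnerProductSpace ℂ H₁]
    [NormedAddCommGroup H₂] [InnerProductSpace ℂ H₂] (x x' : H₁) (y y' : H₂) :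
    ⟪htmul x y, htmul x' y'⟫_ℂ = ⟪x, x'⟫_ℂ * ⟪y, y'⟫_ℂ := by
  simp [htmul, UniformSpace.Completion.inner_coe]

/-! ### Trace class, trace, density operators, partial traces -/

/-- A bounded operator `A` is trace class if `∑ᵢ ⟨|A| eᵢ, eᵢ⟩ < ∞` for orthonormal bases `(eᵢ)`,
where `|A| = (A* A)^{1/2}`. -/
def IsTraceClass {H : Type u} [NormedAddCommGroup H] [InnerProductSpace ℂ H] [CompleteSpace H]
    (A : H →L[ℂ] H) : Prop :=
  ∀ (ι : Type u) (e : HilbertBasis ι ℂ H),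
    Summable fun i => RCLike.re ⟪e i, CFC.abs A (e i)⟫_ℂ

/-- `A` has the trace `c`: `∑ᵢ ⟨A eᵢ, eᵢ⟩ = c` for every orthonormal basis `(eᵢ)`. -/
def HasTrace {H : Type u} [NormedAddCommGroup H] [InnerProductSpace ℂ H]
    (A : H →L[ℂ] H) (c : ℂ) : Prop :=
  ∀ (ι : Type u) (e : HilbertBasis ι ℂ H), HasSum (fun i => ⟪e i, A (e i)⟫_ℂ) c

/-- A density operator: self-adjoint, non-negative, trace class, of trace one. -/
structure IsDensityOperator {H : Type u} [NormedAddCommGroup H] [InnerProductSpace ℂ H]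
    [CompleteSpace H] (ρ : H →L[ℂ] H) : Prop where
  isSelfAdjoint : IsSelfAdjoint ρ
  nonneg : ∀ x, 0 ≤ RCLike.re ⟪x, ρ x⟫_ℂ
  isTraceClass : IsTraceClass ρ
  hasTrace : HasTrace ρ 1

/-- `B` is the partial trace of `A` with respect to `H₁`, i.e. the operator on `H₁` obtained by
tracing out `H₂`: `⟨B x, y⟩ = ∑ᵢ ⟨A (x ⊗ eᵢ), y ⊗ eᵢ⟩` for every orthonormal basis `(eᵢ)` of
`H₂`. -/
def IsPartialTraceFst {H₁ : Type u} {H₂ : Type v} [NormedAddCommGroup H₁] [InnerProductSpace ℂ H₁]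
    [NormedAddCommGroup H₂] [InnerProductSpace ℂ H₂]
    (A : HTensor H₁ H₂ →L[ℂ] HTensor H₁ H₂) (B : H₁ →L[ℂ] H₁) : Prop :=
  ∀ (ι : Type v) (e : HilbertBasis ι ℂ H₂) (x y : H₁),
    HasSum (fun i => ⟪htmul y (e i), A (htmul x (e i))⟫_ℂ) ⟪y, B x⟫_ℂ

/-- `B` is the partial trace of `A` with respect to `H₂`, i.e. the operator on `H₂` obtained by
tracing out `H₁`: `⟨B x, y⟩ = ∑ᵢ ⟨A (eᵢ ⊗ x), eᵢ ⊗ y⟩` for every orthonormal basis `(eᵢ)` of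
`H₁`. -/
def IsPartialTraceSnd {H₁ : Type u} {H₂ : Type v} [NormedAddCommGroup H₁] [InnerProductSpace ℂ H₁]
    [NormedAddCommGroup H₂] [InnerProductSpace ℂ H₂]
    (A : HTensor H₁ H₂ →L[ℂ] HTensor H₁ H₂) (B : H₂ →L[ℂ] H₂) : Prop :=
  ∀ (ι : Type u) (e : HilbertBasis ι ℂ H₁) (x y : H₂),
    HasSum (fun i => ⟪htmul (e i) y, A (htmul (e i) x)⟫_ℂ) ⟪y, B x⟫_ℂ

/-- The partial trace is unique. -/
theorem IsPartialTraceFst.unique {H₁ : Type u} {H₂ : Type v} [NormedAddCommGroup H₁]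
    [InnerProductSpace ℂ H₁] [NormedAddCommGroup H₂] [InnerProductSpace ℂ H₂] [CompleteSpace H₂]
    {A : HTensor H₁ H₂ →L[ℂ] HTensor H₁ H₂} {B B' : H₁ →L[ℂ] H₁}
    (h : IsPartialTraceFst A B) (h' : IsPartialTraceFst A B') : B = B' := by
  obtain ⟨w, e, -⟩ := exists_hilbertBasis ℂ H₂
  exact ContinuousLinearMap.ext fun x =>
    ext_inner_left ℂ fun y => (h w e x y).unique (h' w e x y)

/-- The partial trace sends `A₁ ⊗ A₂` to `Tr(A₂) A₁`. -/
theorem IsPartialTraceFst.of_tensor {H₁ : Type u} {H₂ : Type v} [NormedAddCommGroup H₁]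
    [InnerProductSpace ℂ H₁] [NormedAddCommGroup H₂] [InnerProductSpace ℂ H₂]
    {A : HTensor H₁ H₂ →L[ℂ] HTensor H₁ H₂} {A₁ : H₁ →L[ℂ] H₁} {A₂ : H₂ →L[ℂ] H₂} {c : ℂ}
    (hA : ∀ x y, A (htmul x y) = htmul (A₁ x) (A₂ y)) (hc : HasTrace A₂ c) :
    IsPartialTraceFst A (c • A₁) := by
  intro ι e x y
  simp only [hA, inner_htmul, smul_apply, inner_smul_right]
  rw [mul_comm]
  exact (hc ι e).mul_left _

/-! ### Continuous multipliers -/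

/-- `M` is the continuous multiplier `M_{m,F,G}`, weakly defined by
`⟨M f, g⟩ = ∫ m(x) ⟨f, F x⟩ ⟨G x, g⟩ dμ(x)` for all `f` and `g`, the integrals being absolutely
convergent. -/
def IsMultiplier {X : Type*} [MeasurableSpace X] {H : Type*} [NormedAddCommGroup H]
    [InnerProductSpace ℂ H] (μ : Measure X) (m : X → ℂ) (F G : X → H) (M : H →L[ℂ] H) : Prop :=
  ∀ f g : H, Integrable (fun x => m x * ⟪F x, f⟫_ℂ * ⟪g, G x⟫_ℂ) μ ∧
    ⟪g, M f⟫_ℂ = ∫ x, m x * ⟪F x, f⟫_ℂ * ⟪g, G x⟫_ℂ ∂μ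

/-- The weak definition determines the multiplier. -/
theorem IsMultiplier.unique {X : Type*} [MeasurableSpace X] {H : Type*} [NormedAddCommGroup H]
    [InnerProductSpace ℂ H] {μ : Measure X} {m : X → ℂ} {F G : X → H} {M M' : H →L[ℂ] H}
    (h : IsMultiplier μ m F G M) (h' : IsMultiplier μ m F G M') : M = M' :=
  ContinuousLinearMap.ext fun f =>
    ext_inner_left ℂ fun g => (h f g).2.trans (h' f g).2.symm

open Classical in
/-- The continuous multiplier `M_{m,F,G}`, where it exists as a bounded operator (and `0` where it
does not: results on it state `IsMultiplier` as well). -/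
def multiplier {X : Type*} [MeasurableSpace X] {H : Type*} [NormedAddCommGroup H]
    [InnerProductSpace ℂ H] (μ : Measure X) (m : X → ℂ) (F G : X → H) : H →L[ℂ] H :=
  if h : ∃ M, IsMultiplier μ m F G M then h.choose else 0

/-! ### Time-frequency shifts -/

/-- `L²(ℝᵈ)`. -/
abbrev L2 (d : ℕ) : Type := Lp ℂ 2 (volume : Measure (EuclideanSpace ℝ (Fin d)))

/-- The phase space `ℝ²ᵈ` of the points `(x, ω)`, with Lebesgue measure. -/
abbrev Phase (d : ℕ) : Type := EuclideanSpace ℝ (Fin d) × EuclideanSpace ℝ (Fin d)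

theorem memLp_shift {d : ℕ} (z : Phase d) (φ : L2 d) :
    MemLp (fun t : EuclideanSpace ℝ (Fin d) =>
      Complex.exp (2 * Real.pi * Complex.I * (⟪z.2, t⟫_ℝ : ℝ)) * φ (t - z.1)) 2 volume := by
  have h1 : MemLp (fun t => φ (t - z.1)) 2 volume :=
    (Lp.memLp φ).comp_measurePreserving (measurePreserving_sub_right volume z.1)
  refine h1.of_le (AEStronglyMeasurable.mul ?_ h1.1) (Filter.Eventually.of_forall fun t => ?_)
  · exact Continuous.aestronglyMeasurable (by fun_prop)
  · have : (2 * Real.pi * Complex.I * (⟪z.2, t⟫_ℝ : ℝ) : ℂ)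
        = ((2 * Real.pi * ⟪z.2, t⟫_ℝ : ℝ) : ℂ) * Complex.I := by push_cast; ring
    rw [norm_mul, this, Complex.norm_exp_ofReal_mul_I, one_mul]

/-- The time-frequency shift `π(x, ω) φ = M_ω T_x φ`, that is `t ↦ e^{2πi ω·t} φ(t - x)`, for
`z = (x, ω)` and `φ ∈ L²(ℝᵈ)`. -/
def tfShift {d : ℕ} (z : Phase d) (φ : L2 d) : L2 d :=
  (memLp_shift z φ).toLp

end QuantumLoc

end

open QuantumLoc

/-! For a real weight `m`, the diagonal form of the multiplier is `∫ m |⟨f, F x⟩|²`, so `m ≥ 0`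
makes the operator positive. If `‖F x‖ = C`, Parseval turns the sum of this form over an orthonormal
basis into the trace `C² ∫ m`, which the normalization makes equal to 1 (`IsMultiplier.hasTrace`).
For a product weight along elementary tensors, Fubini factors the matrix coefficients between
elementary tensors (`IsMultiplier.inner_htmul`). Tracing out one factor then leaves the other
multiplier times a trace equal to 1. Time-frequency shifts enter only through `norm_tfShift` and
`stronglyMeasurable_inner_tfShift`. -/

open TopologicalSpace

namespace QuantumLoc

/-! ### Multipliers with integrable real symbol: existence, positivity, trace -/

section Multiplier

variable {H : Type u} [NormedAddCommGroup H] [InnerProductSpace ℂ H]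

theorem norm_multiplier_integrand_le {X : Type*} {m : X → ℝ} {F : X → H} {C : ℝ} (hC : ∀ x, ‖F x‖ ≤ C) (f g : H) (x : X) :
    ‖(m x : ℂ) * ⟪F x, f⟫_ℂ * ⟪g, F x⟫_ℂ‖ ≤ ‖m x‖ * (C ^ 2 * ‖g‖ * ‖f‖) := by
  have hC0 : 0 ≤ C := (norm_nonneg _).trans (hC x)
  have h1 : ‖⟪F x, f⟫_ℂ‖ ≤ C * ‖f‖ :=
    (norm_inner_le_norm _ _).trans (by gcongr; exact hC x)
  have h2 : ‖⟪g, F x⟫_ℂ‖ ≤ ‖g‖ * C :=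
    (norm_inner_le_norm _ _).trans (by gcongr; exact hC x)
  rw [norm_mul, norm_mul, Complex.norm_real, mul_assoc]
  calc ‖m x‖ * (‖⟪F x, f⟫_ℂ‖ * ‖⟪g, F x⟫_ℂ‖) ≤ ‖m x‖ * ((C * ‖f‖) * (‖g‖ * C)) := by gcongr
    _ = _ := by ring

variable {X : Type*} [MeasurableSpace X] {μ : Measure X} {m : X → ℝ} {F : X → H} {C : ℝ}

theorem integrable_multiplier_integrand (hm : Integrable m μ)
    (hF : ∀ g, AEStronglyMeasurable (fun x => ⟪F x, g⟫_ℂ) μ) (hC : ∀ x, ‖F x‖ ≤ C) (f g : H) :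
    Integrable (fun x => (m x : ℂ) * ⟪F x, f⟫_ℂ * ⟪g, F x⟫_ℂ) μ := by
  refine (hm.norm.mul_const (C ^ 2 * ‖g‖ * ‖f‖)).mono' ?_
    (.of_forall (norm_multiplier_integrand_le hC f g))
  have h : AEStronglyMeasurable (fun x => ⟪g, F x⟫_ℂ) μ := by
    have := Complex.continuous_conj.comp_aestronglyMeasurable (hF g)
    simpa only [inner_conj_symm] using this
  exact ((Complex.continuous_ofReal.comp_aestronglyMeasurable hm.1).mul (hF f)).mul h

/-- The weak integral is a sesquilinear form bounded by `C² ‖m‖₁`, so the Riesz representation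
theorem applies. -/
theorem exists_isMultiplier [CompleteSpace H] (hm : Integrable m μ)
    (hF : ∀ g, AEStronglyMeasurable (fun x => ⟪F x, g⟫_ℂ) μ) (hC : ∀ x, ‖F x‖ ≤ C) :
    ∃ M, IsMultiplier μ (fun x => (m x : ℂ)) F F M := by
  have hint := integrable_multiplier_integrand hm hF hC
  let B : H →ₗ⋆[ℂ] H →ₗ[ℂ] ℂ := LinearMap.mk₂'ₛₗ (starRingEnd ℂ) (RingHom.id ℂ)
    (fun g f => ∫ x, (m x : ℂ) * ⟪F x, f⟫_ℂ * ⟪g, F x⟫_ℂ ∂μ)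
    (fun g g' f => by
      rw [← integral_add (hint f g) (hint f g')]
      exact integral_congr_ae (.of_forall fun x => by simp only [inner_add_left, mul_add]))
    (fun c g f => by
      rw [smul_eq_mul, ← integral_const_mul]
      exact integral_congr_ae (.of_forall fun x => by simp only [inner_smul_left]; ring))
    (fun g f f' => by
      rw [← integral_add (hint f g) (hint f' g)]
      exact integral_congr_ae (.of_forall fun x => by
        simp only [inner_add_right, mul_add, add_mul]))
    (fun c g f => by
      rw [smul_eq_mul, ← integral_const_mul]
      exact integral_congr_ae (.of_forall fun x => by
        simp only [inner_smul_right, RingHom.id_apply]; ring))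
  have hB : ∀ g f, ‖B g f‖ ≤ ((∫ x, ‖m x‖ ∂μ) * C ^ 2) * ‖g‖ * ‖f‖ := fun g f => by
    refine (norm_integral_le_of_norm_le (hm.norm.mul_const (C ^ 2 * ‖g‖ * ‖f‖))
      (.of_forall (norm_multiplier_integrand_le hC f g))).trans_eq ?_
    rw [integral_mul_const]
    ring
  -- The Riesz operator of `B` acts on `g`; the adjoint moves it to `f`.
  refine ⟨ContinuousLinearMap.adjoint
    (InnerProductSpace.continuousLinearMapOfBilin (B.mkContinuous₂ _ hB)), fun f g => ⟨hint f g, ?_⟩⟩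
  rw [ContinuousLinearMap.adjoint_inner_right,
    InnerProductSpace.continuousLinearMapOfBilin_apply]
  rfl

theorem isMultiplier_multiplier {m : X → ℂ} {G : X → H} (h : ∃ M, IsMultiplier μ m F G M) :
    IsMultiplier μ m F G (multiplier μ m F G) := by
  rw [multiplier, dif_pos h]
  exact h.choose_spec

theorem IsMultiplier.inner_self {M : H →L[ℂ] H} (hM : IsMultiplier μ (fun x => (m x : ℂ)) F F M)
    (f : H) : ⟪f, M f⟫_ℂ = ((∫ x, m x * ‖⟪F x, f⟫_ℂ‖ ^ 2 ∂μ : ℝ) : ℂ) := by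
  rw [(hM f f).2, ← integral_complex_ofReal]
  refine integral_congr_ae (.of_forall fun x => ?_)
  simp only
  rw [mul_assoc, ← inner_conj_symm f (F x), RCLike.mul_conj]
  push_cast
  rfl

theorem IsMultiplier.isPositive [CompleteSpace H] {M : H →L[ℂ] H}
    (hM : IsMultiplier μ (fun x => (m x : ℂ)) F F M) (hm : ∀ᵐ x ∂μ, 0 ≤ m x) :
    M.IsPositive := by
  rw [ContinuousLinearMap.isPositive_iff_complex]
  intro f
  rw [← inner_conj_symm, hM.inner_self f, Complex.conj_ofReal]
  refine ⟨by simp, ?_⟩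
  change 0 ≤ (Complex.ofReal _).re
  rw [Complex.ofReal_re]
  exact integral_nonneg_of_ae (hm.mono fun x hx => mul_nonneg hx (sq_nonneg _))

/-- Distinct basis vectors lie at distance `√2`, so balls of radius `1/2` around them are disjoint.
Countability is what dominated convergence for series requires. -/
theorem countable_of_hilbertBasis [SeparableSpace H] {ι : Type*} (e : HilbertBasis ι ℂ H) :
    Countable ι := by
  refine Pairwise.countable_of_isOpen_disjoint (s := fun i => Metric.ball (e i) (1 / 2)) ?_
    (fun i => Metric.isOpen_ball) (fun i => Metric.nonempty_ball.2 (by norm_num))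
  intro i j hij
  refine Metric.ball_disjoint_ball ?_
  have h : ‖e i - e j‖ * ‖e i - e j‖ = 2 := by
    rw [@norm_sub_mul_self ℂ, e.orthonormal.inner_eq_zero hij, e.orthonormal.norm_eq_one,
      e.orthonormal.norm_eq_one]
    norm_num
  rw [dist_eq_norm]
  nlinarith [norm_nonneg (e i - e j)]

theorem hasSum_norm_inner_sq {ι : Type*} (e : HilbertBasis ι ℂ H) (f : H) :
    HasSum (fun i => ‖⟪f, e i⟫_ℂ‖ ^ 2) (‖f‖ ^ 2) := by
  have h := RCLike.hasSum_re ℂ (e.hasSum_inner_mul_inner f f)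
  rw [inner_self_eq_norm_sq] at h
  refine h.congr_fun fun i => ?_
  rw [← inner_conj_symm (e i) f, RCLike.mul_conj]
  norm_cast

theorem IsMultiplier.hasTrace [SeparableSpace H] {M : H →L[ℂ] H}
    (hM : IsMultiplier μ (fun x => (m x : ℂ)) F F M) (hm : Integrable m μ)
    (hF : ∀ g, AEStronglyMeasurable (fun x => ⟪F x, g⟫_ℂ) μ) (hC : ∀ x, ‖F x‖ = C) :
    HasTrace M ((∫ x, m x ∂μ) * C ^ 2 : ℝ) := by
  intro ι e
  have := countable_of_hilbertBasis e
  simp only [hM.inner_self]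
  rw [Complex.hasSum_ofReal, ← integral_mul_const]
  have hs : ∀ x, HasSum (fun i => ‖⟪F x, e i⟫_ℂ‖ ^ 2) (C ^ 2) := fun x => by
    simpa only [hC] using hasSum_norm_inner_sq e (F x)
  have hn : ∀ i x, ‖m x * ‖⟪F x, e i⟫_ℂ‖ ^ 2‖ = ‖m x‖ * ‖⟪F x, e i⟫_ℂ‖ ^ 2 := fun i x => by
    rw [norm_mul, Real.norm_of_nonneg (sq_nonneg _)]
  -- The terms are dominated by their absolute values, whose sum is `‖m x‖ * C ^ 2` by Parseval, an
  -- integrable function.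
  refine hasSum_integral_of_dominated_convergence
    (fun i x => ‖m x‖ * ‖⟪F x, e i⟫_ℂ‖ ^ 2) (fun i => hm.1.mul ((hF (e i)).norm.pow 2))
    (fun i => .of_forall fun x => (hn i x).le)
    (.of_forall fun x => ((hs x).mul_left _).summable) ?_
    (.of_forall fun x => (hs x).mul_left _)
  simp only [fun x => ((hs x).mul_left ‖m x‖).tsum_eq]
  exact hm.norm.mul_const _

/-- Since `|M| = M`, convergence of the trace series already gives trace class. -/
theorem isDensityOperator_of_isPositive [CompleteSpace H] {M : H →L[ℂ] H} (hM : M.IsPositive)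
    (h : HasTrace M 1) : IsDensityOperator M where
  isSelfAdjoint := hM.isSelfAdjoint
  nonneg := hM.re_inner_nonneg_right
  isTraceClass := fun ι e => by
    rw [CFC.abs_of_nonneg M (M.nonneg_iff_isPositive.2 hM)]
    exact (RCLike.hasSum_re ℂ (h ι e)).summable
  hasTrace := h

theorem IsMultiplier.isDensityOperator [CompleteSpace H] [SeparableSpace H] {M : H →L[ℂ] H}
    (hM : IsMultiplier μ (fun x => (m x : ℂ)) F F M) (hm : Integrable m μ)
    (hm0 : ∀ᵐ x ∂μ, 0 ≤ m x) (hF : ∀ g, AEStronglyMeasurable (fun x => ⟪F x, g⟫_ℂ) μ)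
    (hC : ∀ x, ‖F x‖ = C) (h1 : (∫ x, m x ∂μ) * C ^ 2 = 1) : IsDensityOperator M :=
  isDensityOperator_of_isPositive (hM.isPositive hm0) <| by
    simpa only [h1, Complex.ofReal_one] using hM.hasTrace hm hF hC

end Multiplier

/-! ### Hilbert tensor products and factorization of multipliers -/

section Tensor

variable {H₁ : Type u} {H₂ : Type v} [NormedAddCommGroup H₁] [InnerProductSpace ℂ H₁]
  [NormedAddCommGroup H₂] [InnerProductSpace ℂ H₂]

theorem norm_htmul (x : H₁) (y : H₂) : ‖htmul x y‖ = ‖x‖ * ‖y‖ := by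
  rw [htmul, UniformSpace.Completion.norm_coe, TensorProduct.norm_tmul]

/-- Elementary tensors form a continuous image of the separable space `H₁ × H₂`, and they span. -/
theorem separableSpace_tensorProduct [SeparableSpace H₁] [SeparableSpace H₂] :
    SeparableSpace (H₁ ⊗[ℂ] H₂) := by
  have hs : IsSeparable (Set.range fun p : H₁ × H₂ => p.1 ⊗ₜ[ℂ] p.2) :=
    isSeparable_range (TensorProduct.mkL ℂ H₁ H₂).continuous₂
  rw [← isSeparable_univ_iff]
  convert hs.span (R := ℂ)
  rw [eq_comm, ← Submodule.top_coe (R := ℂ), ← TensorProduct.span_tmul_eq_top ℂ H₁ H₂]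
  congr 2
  ext t
  simp

theorem aestronglyMeasurable_inner_of_htmul {X : Type*} [MeasurableSpace X] {μ : Measure X}
    {F : X → HTensor H₁ H₂}
    (hF : ∀ x y, AEStronglyMeasurable (fun z => ⟪F z, htmul x y⟫_ℂ) μ) (g : HTensor H₁ H₂) :
    AEStronglyMeasurable (fun z => ⟪F z, g⟫_ℂ) μ := by
  induction g using UniformSpace.Completion.induction_on with
  | hp =>
    -- Pointwise limits of sequences preserve measurability, and sequences detect closedness in the
    -- metric completion.
    refine IsSeqClosed.isClosed fun u a hu ha => ?_
    exact aestronglyMeasurable_of_tendsto_ae Filter.atTop hu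
      (.of_forall fun z => tendsto_const_nhds.inner ha)
  | ih t =>
    induction t using TensorProduct.induction_on with
    | zero =>
      simpa only [UniformSpace.Completion.coe_zero, inner_zero_right] using
        aestronglyMeasurable_const
    | tmul x y => exact hF x y
    | add s t hs ht =>
      simpa only [UniformSpace.Completion.coe_add, inner_add_right] using hs.fun_add ht

variable {X₁ X₂ : Type*} [MeasurableSpace X₁] [MeasurableSpace X₂] {μ₁ : Measure X₁}
  {μ₂ : Measure X₂} {m₁ : X₁ → ℂ} {m₂ : X₂ → ℂ} {F₁ : X₁ → H₁} {F₂ : X₂ → H₂}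

theorem aestronglyMeasurable_inner_htmul
    (hF₁ : ∀ g, AEStronglyMeasurable (fun x => ⟪F₁ x, g⟫_ℂ) μ₁)
    (hF₂ : ∀ g, AEStronglyMeasurable (fun x => ⟪F₂ x, g⟫_ℂ) μ₂) (g : HTensor H₁ H₂) :
    AEStronglyMeasurable (fun z : X₁ × X₂ => ⟪htmul (F₁ z.1) (F₂ z.2), g⟫_ℂ) (μ₁.prod μ₂) := by
  refine aestronglyMeasurable_inner_of_htmul (fun x y => ?_) g
  simp only [inner_htmul]
  exact (hF₁ x).comp_fst.mul (hF₂ y).comp_snd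

variable [SFinite μ₁] [SFinite μ₂]

theorem IsMultiplier.inner_htmul {M : HTensor H₁ H₂ →L[ℂ] HTensor H₁ H₂} {M₁ : H₁ →L[ℂ] H₁}
    {M₂ : H₂ →L[ℂ] H₂}
    (hM : IsMultiplier (μ₁.prod μ₂) (fun z => m₁ z.1 * m₂ z.2)
      (fun z => htmul (F₁ z.1) (F₂ z.2)) (fun z => htmul (F₁ z.1) (F₂ z.2)) M)
    (hM₁ : IsMultiplier μ₁ m₁ F₁ F₁ M₁) (hM₂ : IsMultiplier μ₂ m₂ F₂ F₂ M₂)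
    (x x' : H₁) (y y' : H₂) :
    ⟪htmul x' y', M (htmul x y)⟫_ℂ = ⟪x', M₁ x⟫_ℂ * ⟪y', M₂ y⟫_ℂ := by
  rw [(hM _ _).2, (hM₁ _ _).2, (hM₂ _ _).2, ← integral_prod_mul]
  refine integral_congr_ae (.of_forall fun z => ?_)
  simp only [QuantumLoc.inner_htmul]
  ring

theorem IsMultiplier.isPartialTraceFst {M : HTensor H₁ H₂ →L[ℂ] HTensor H₁ H₂}
    {M₁ : H₁ →L[ℂ] H₁} {M₂ : H₂ →L[ℂ] H₂}
    (hM : IsMultiplier (μ₁.prod μ₂) (fun z => m₁ z.1 * m₂ z.2)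
      (fun z => htmul (F₁ z.1) (F₂ z.2)) (fun z => htmul (F₁ z.1) (F₂ z.2)) M)
    (hM₁ : IsMultiplier μ₁ m₁ F₁ F₁ M₁) (hM₂ : IsMultiplier μ₂ m₂ F₂ F₂ M₂)
    (h : HasTrace M₂ 1) : IsPartialTraceFst M M₁ := fun ι e x y => by
  simpa only [hM.inner_htmul hM₁ hM₂, mul_one] using (h ι e).mul_left ⟪y, M₁ x⟫_ℂ

theorem IsMultiplier.isPartialTraceSnd {M : HTensor H₁ H₂ →L[ℂ] HTensor H₁ H₂}
    {M₁ : H₁ →L[ℂ] H₁} {M₂ : H₂ →L[ℂ] H₂}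
    (hM : IsMultiplier (μ₁.prod μ₂) (fun z => m₁ z.1 * m₂ z.2)
      (fun z => htmul (F₁ z.1) (F₂ z.2)) (fun z => htmul (F₁ z.1) (F₂ z.2)) M)
    (hM₁ : IsMultiplier μ₁ m₁ F₁ F₁ M₁) (hM₂ : IsMultiplier μ₂ m₂ F₂ F₂ M₂)
    (h : HasTrace M₁ 1) : IsPartialTraceSnd M M₂ := fun ι e x y => by
  simpa only [hM.inner_htmul hM₁ hM₂, one_mul] using (h ι e).mul_right ⟪y, M₂ x⟫_ℂ

end Tensor

/-- The multiplier of a product weight along elementary tensors is a density operator, and so are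
the multipliers of the factors, which are its partial traces. -/
theorem tensor_multiplier_spec {H₁ : Type u} {H₂ : Type u} [NormedAddCommGroup H₁]
    [InnerProductSpace ℂ H₁] [CompleteSpace H₁] [SeparableSpace H₁] [NormedAddCommGroup H₂]
    [InnerProductSpace ℂ H₂] [CompleteSpace H₂] [SeparableSpace H₂] {X₁ X₂ : Type*}
    [MeasurableSpace X₁] [MeasurableSpace X₂] {μ₁ : Measure X₁} {μ₂ : Measure X₂} [SFinite μ₁]
    [SFinite μ₂] {m₁ : X₁ → ℝ} {m₂ : X₂ → ℝ} {F₁ : X₁ → H₁} {F₂ : X₂ → H₂} {C₁ C₂ : ℝ}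
    (hi₁ : Integrable m₁ μ₁) (hi₂ : Integrable m₂ μ₂)
    (hp₁ : ∀ᵐ x ∂μ₁, 0 ≤ m₁ x) (hp₂ : ∀ᵐ x ∂μ₂, 0 ≤ m₂ x)
    (hF₁ : ∀ g, AEStronglyMeasurable (fun x => ⟪F₁ x, g⟫_ℂ) μ₁)
    (hF₂ : ∀ g, AEStronglyMeasurable (fun x => ⟪F₂ x, g⟫_ℂ) μ₂)
    (hC₁ : ∀ x, ‖F₁ x‖ = C₁) (hC₂ : ∀ x, ‖F₂ x‖ = C₂)
    (h₁ : (∫ x, m₁ x ∂μ₁) * C₁ ^ 2 = 1) (h₂ : (∫ x, m₂ x ∂μ₂) * C₂ ^ 2 = 1)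
    {m : X₁ × X₂ → ℂ} (hm : ∀ x₁ x₂, m (x₁, x₂) = (m₁ x₁ : ℂ) * (m₂ x₂ : ℂ))
    {F : X₁ × X₂ → HTensor H₁ H₂} (hF : ∀ x₁ x₂, F (x₁, x₂) = htmul (F₁ x₁) (F₂ x₂))
    {M : HTensor H₁ H₂ →L[ℂ] HTensor H₁ H₂} (hM : M = multiplier (μ₁.prod μ₂) m F F)
    {M₁ : H₁ →L[ℂ] H₁} (hM₁ : M₁ = multiplier μ₁ (fun x => (m₁ x : ℂ)) F₁ F₁)
    {M₂ : H₂ →L[ℂ] H₂} (hM₂ : M₂ = multiplier μ₂ (fun x => (m₂ x : ℂ)) F₂ F₂) :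
    (IsMultiplier (μ₁.prod μ₂) m F F M ∧ IsMultiplier μ₁ (fun x => (m₁ x : ℂ)) F₁ F₁ M₁ ∧
      IsMultiplier μ₂ (fun x => (m₂ x : ℂ)) F₂ F₂ M₂) ∧
    IsDensityOperator M ∧ IsDensityOperator M₁ ∧ IsDensityOperator M₂ ∧
    IsPartialTraceFst M M₁ ∧ IsPartialTraceSnd M M₂ := by
  have := separableSpace_tensorProduct (H₁ := H₁) (H₂ := H₂)
  obtain rfl : F = fun z => htmul (F₁ z.1) (F₂ z.2) := funext fun z => hF z.1 z.2
  obtain rfl : m = fun z => (m₁ z.1 : ℂ) * (m₂ z.2 : ℂ) := funext fun z => hm z.1 z.2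
  have hMul₁ := isMultiplier_multiplier (exists_isMultiplier hi₁ hF₁ fun x => (hC₁ x).le)
  have hMul₂ := isMultiplier_multiplier (exists_isMultiplier hi₂ hF₂ fun x => (hC₂ x).le)
  rw [← hM₁] at hMul₁
  rw [← hM₂] at hMul₂
  have hi : Integrable (fun z : X₁ × X₂ => m₁ z.1 * m₂ z.2) (μ₁.prod μ₂) := hi₁.mul_prod hi₂
  have hFF := aestronglyMeasurable_inner_htmul hF₁ hF₂
  have hC : ∀ z : X₁ × X₂, ‖htmul (F₁ z.1) (F₂ z.2)‖ = C₁ * C₂ := fun z => by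
    rw [norm_htmul, hC₁, hC₂]
  have hMul := isMultiplier_multiplier (exists_isMultiplier hi hFF fun z => (hC z).le)
  have hp : ∀ᵐ z ∂μ₁.prod μ₂, 0 ≤ m₁ z.1 * m₂ z.2 := by
    filter_upwards [Measure.quasiMeasurePreserving_fst.ae hp₁,
      Measure.quasiMeasurePreserving_snd.ae hp₂] with z h h'
    exact mul_nonneg h h'
  have h : (∫ z, m₁ z.1 * m₂ z.2 ∂μ₁.prod μ₂) * (C₁ * C₂) ^ 2 = 1 := by
    rw [integral_prod_mul, mul_pow, mul_mul_mul_comm, h₁, h₂, one_mul]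
  have hD₁ := hMul₁.isDensityOperator hi₁ hp₁ hF₁ hC₁ h₁
  have hD₂ := hMul₂.isDensityOperator hi₂ hp₂ hF₂ hC₂ h₂
  have hD := hMul.isDensityOperator hi hp hFF hC h
  -- The general results were applied to the real weight `m₁ m₂`; its cast is split to match the
  -- complex symbol.
  simp only [Complex.ofReal_mul] at hMul hD
  rw [← hM] at hMul hD
  have hT₁ : IsPartialTraceFst M M₁ :=
    IsMultiplier.isPartialTraceFst (m₁ := fun x => (m₁ x : ℂ)) (m₂ := fun x => (m₂ x : ℂ))
      (F₁ := F₁) (F₂ := F₂) hMul hMul₁ hMul₂ hD₂.hasTrace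
  have hT₂ : IsPartialTraceSnd M M₂ :=
    IsMultiplier.isPartialTraceSnd (m₁ := fun x => (m₁ x : ℂ)) (m₂ := fun x => (m₂ x : ℂ))
      (F₁ := F₁) (F₂ := F₂) hMul hMul₁ hMul₂ hD₁.hasTrace
  exact ⟨⟨hMul, hMul₁, hMul₂⟩, hD, hD₁, hD₂, hT₁, hT₂⟩

/-! ### Time-frequency shifts: isometry and weak measurability -/

section Shift

variable {d : ℕ}

theorem separableSpace_L2 (d : ℕ) : SeparableSpace (L2 d) := by
  have : Fact ((2 : ENNReal) ≠ ⊤) := ⟨by norm_num⟩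
  have : SecondCountableTopology (L2 d) := Lp.SecondCountableTopology
  infer_instance

/-- Modulation is unimodular and translation preserves Lebesgue measure. -/
theorem norm_tfShift (z : Phase d) (φ : L2 d) : ‖tfShift z φ‖ = ‖φ‖ := by
  rw [tfShift, Lp.norm_toLp, Lp.norm_def]
  congr 1
  rw [← eLpNorm_comp_measurePreserving (Lp.memLp φ).1
    (measurePreserving_sub_right volume z.1)]
  refine eLpNorm_congr_norm_ae (.of_forall fun t => ?_)
  have : (2 * Real.pi * Complex.I * (⟪z.2, t⟫_ℝ : ℝ) : ℂ)
      = ((2 * Real.pi * ⟪z.2, t⟫_ℝ : ℝ) : ℂ) * Complex.I := by push_cast; ring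
  rw [norm_mul, this, Complex.norm_exp_ofReal_mul_I, one_mul]
  rfl

/-- For each `z`, the class `tfShift z φ` can be replaced under the integral by its explicit
formula, which is jointly measurable in `(z, t)`; integrating out `t` preserves measurability. -/
theorem stronglyMeasurable_inner_tfShift (φ g : L2 d) :
    StronglyMeasurable fun z : Phase d => ⟪tfShift z φ, g⟫_ℂ := by
  have h : (fun z : Phase d => ⟪tfShift z φ, g⟫_ℂ) = fun z => ∫ t,
      ⟪Complex.exp (2 * Real.pi * Complex.I * (⟪z.2, t⟫_ℝ : ℝ)) * φ (t - z.1), g t⟫_ℂ := by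
    ext z
    rw [L2.inner_def]
    refine integral_congr_ae ?_
    filter_upwards [(memLp_shift z φ).coeFn_toLp] with t ht
    rw [tfShift, ht]
  rw [h]
  refine StronglyMeasurable.integral_prod_right (f := fun (z : Phase d) t =>
    ⟪Complex.exp (2 * Real.pi * Complex.I * (⟪z.2, t⟫_ℝ : ℝ)) * φ (t - z.1), g t⟫_ℂ) ?_
  refine StronglyMeasurable.inner (.mul ?_ ?_) ?_
  · exact Continuous.stronglyMeasurable (by fun_prop)
  · exact (Lp.stronglyMeasurable φ).comp_measurable (by fun_prop)
  · exact (Lp.stronglyMeasurable g).comp_measurable measurable_snd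

end Shift

end QuantumLoc

theorem theorem7p4 (d : ℕ) (φ₁ φ₂ : L2 d) (hφ₁ : φ₁ ≠ 0) (hφ₂ : φ₂ ≠ 0)
    (m₁ m₂ : Phase d → ℝ)
    (hm₁_L1 : MemLp m₁ 1 volume) (hm₁_Linf : MemLp m₁ ⊤ volume) (hm₁_pos : ∀ᵐ z, 0 < m₁ z)
    (hm₂_L1 : MemLp m₂ 1 volume) (hm₂_Linf : MemLp m₂ ⊤ volume) (hm₂_pos : ∀ᵐ z, 0 < m₂ z)
    (hm₁_int : ∫ z, m₁ z = 1 / ‖φ₁‖ ^ 2) (hm₂_int : ∫ z, m₂ z = 1 / ‖φ₂‖ ^ 2)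
    (m : Phase d × Phase d → ℂ)
    (hm : ∀ z₁ z₂, m (z₁, z₂) = (m₁ z₁ : ℂ) * (m₂ z₂ : ℂ))
    (F : Phase d × Phase d →
      HTensor (L2 d) (L2 d))
    (hF : ∀ z₁ z₂,
      F (z₁, z₂) = htmul (tfShift z₁ φ₁) (tfShift z₂ φ₂))
    (M : HTensor (L2 d) (L2 d) →L[ℂ]
      HTensor (L2 d) (L2 d))
    (hM : M = multiplier volume m F F)
    (M₁ M₂ : L2 d →L[ℂ] L2 d)
    (hM₁ : M₁ = multiplier volume (fun z => (m₁ z : ℂ))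
      (fun z => tfShift z φ₁) (fun z => tfShift z φ₁))
    (hM₂ : M₂ = multiplier volume (fun z => (m₂ z : ℂ))
      (fun z => tfShift z φ₂) (fun z => tfShift z φ₂)) :
    -- the weak integrals define bounded operators
    (IsMultiplier volume m F F M ∧
      IsMultiplier volume (fun z => (m₁ z : ℂ))
        (fun z => tfShift z φ₁) (fun z => tfShift z φ₁) M₁ ∧
      IsMultiplier volume (fun z => (m₂ z : ℂ))
        (fun z => tfShift z φ₂) (fun z => tfShift z φ₂) M₂) ∧
    -- the multiplier and its partial traces are density operators
    IsDensityOperator M ∧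
    IsDensityOperator M₁ ∧ IsDensityOperator M₂ ∧
    IsPartialTraceFst M M₁ ∧ IsPartialTraceSnd M M₂ := by
  have := separableSpace_L2 d
  refine tensor_multiplier_spec (memLp_one_iff_integrable.1 hm₁_L1)
    (memLp_one_iff_integrable.1 hm₂_L1) (hm₁_pos.mono fun _ h => h.le)
    (hm₂_pos.mono fun _ h => h.le)
    (fun g => (stronglyMeasurable_inner_tfShift φ₁ g).aestronglyMeasurable)
    (fun g => (stronglyMeasurable_inner_tfShift φ₂ g).aestronglyMeasurable)
    (fun z => norm_tfShift z φ₁) (fun z => norm_tfShift z φ₂) ?_ ?_ hm hF hM hM₁ hM₂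
  · rw [hm₁_int, one_div_mul_cancel (pow_ne_zero 2 (norm_ne_zero_iff.2 hφ₁))]
  · rw [hm₂_int, one_div_mul_cancel (pow_ne_zero 2 (norm_ne_zero_iff.2 hφ₂))]
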